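/- Let $(P_1,\Lambda_1)$ and $(P_2,\Lambda_2)$ be (finite-dimensional, Hausdorff, smooth) Poisson manifolds, i.e. $\Lambda_i$ is a smooth bivector field with $[\Lambda_i,\Lambda_i]=0$, and let $\Lambda_i^\sharp\colon T^*P_i\to TP_i$ denote contraction with $\Lambda_i$. An embedded submanifold $C$ of a Poisson manifold $(P,\Lambda)$ is called pre-Poisson if the rank of $TC+\Lambda^\sharp N^*C$ is constant along $C$, where $N^*C$ is the annihilator of $TC$. A map $\phi\colon P_1\to P_2$ is called pre-Poisson if its graph is a pre-Poisson submanifold of $(P_1,\Lambda_1)\times(P_2,-\Lambda_2)$. Let $\phi\colon P_1\to P_2$ be a diffeomorphism, and let $D=\{(\Lambda_2-\phi_*\Lambda_1)^\sharp\xi:\xi\in T^*P_2\}$ be its deficit distribution, a possibly singular distribution on $P_2$. The following are equivalent: 1. $\phi$ is a pre-Poisson map; 2. $\Lambda_2-\phi_*\Lambda_1$ is a (smooth) bivector field of constant rank on $P_2$; 3. $D$ is a smooth distribution of constant rank on $P_2$. Moreover, suppose that $D$ is integrable (through each point of $P_2$ passes an integral manifold of $D$) and that the leaf space $P_2/D$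 is smooth, i.e. carries, with its quotient topology, the structure of a Hausdorff smooth manifold for which the projection $\pi\colon P_2\to P_2/D$ is a smooth submersion. Then there is a unique Poisson structure on $P_2/D$ for which $\pi$ is a Poisson map, i.e. a smooth map with $\pi^*\{f,g\}=\{\pi^*f,\pi^*g\}$ for all $f,g\in C^\infty(P_2/D)$. With this Poisson structure the composition $\pi\circ\phi\colon P_1\to P_2/D$ is a Poisson map. -/

import Mathlib

open Set Function
open scoped Manifold ContDiff Topology

noncomputable section

namespace PoissonGeometry

/-! ### Bivector fields and Poisson structures -/

section Basic

variable {E : Type*} [NormedAddCommGroup E] [NormedSpace ℝ E]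
  {H : Type*} [TopologicalSpace H] (I : ModelWithCorners ℝ E H)
  (P : Type*) [TopologicalSpace P] [ChartedSpace H P]

/-- A field of linear maps `T*P → TP`. A bivector field `Λ` is described by its contraction map
`Λ^♯ : T*P → TP`; it is the skew-symmetric smooth fields that are bivector fields, see
`IsBivectorField`. -/
abbrev SharpField : Type _ :=
  ∀ x : P, (TangentSpace I x →L[ℝ] ℝ) →L[ℝ] TangentSpace I x

variable {P}

/-- The differential `d_x f ∈ T*_x P` of a function. -/
def differential (f : P → ℝ) (x : P) : TangentSpace I x →L[ℝ] ℝ :=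
  mfderiv I 𝓘(ℝ, ℝ) f x

variable {I} in
/-- The bracket `{f, g} = df (Λ^♯ dg)`. -/
def bracket (Λ : SharpField I P) (f g : P → ℝ) (x : P) : ℝ :=
  differential I f x (Λ x (differential I g x))

variable {I} in
/-- `Λ` is a smooth bivector field: for finite-dimensional `T_xP`, elements of `∧² T_xP` are the
same as skew-symmetric linear maps `T*_xP → T_xP`, and smoothness is smoothness of the section
of the vector bundle `Hom(T*P, TP)`. -/
structure IsBivectorField [IsManifold I ∞ P] (Λ : SharpField I P) : Prop where
  skew : ∀ (x : P) (ξ η : TangentSpace I x →L[ℝ] ℝ), η (Λ x ξ) = - ξ (Λ x η)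
  smooth : ContMDiff I (I.prod 𝓘(ℝ, (E →L[ℝ] ℝ) →L[ℝ] E)) ∞
    (fun x ↦ Bundle.TotalSpace.mk' ((E →L[ℝ] ℝ) →L[ℝ] E)
      (E := fun x ↦ (TangentSpace I x →L[ℝ] ℝ) →L[ℝ] TangentSpace I x) x (Λ x))

variable {I} in
/-- `Λ` is a Poisson bivector field. The Schouten square `[Λ, Λ]` is the trivector field whose
value on `(df, dg, dh)` is, up to a nonzero constant factor depending on conventions, the cyclic
sum below; so `[Λ, Λ] = 0` is the Jacobi identity of the bracket. -/
structure IsPoisson [IsManifold I ∞ P] (Λ : SharpField I P) : Prop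
    extends IsBivectorField Λ where
  jacobi : ∀ f g h : P → ℝ, ContMDiff I 𝓘(ℝ, ℝ) ∞ f → ContMDiff I 𝓘(ℝ, ℝ) ∞ g →
    ContMDiff I 𝓘(ℝ, ℝ) ∞ h → ∀ x : P,
      bracket Λ f (bracket Λ g h) x + bracket Λ g (bracket Λ h f) x
        + bracket Λ h (bracket Λ f g) x = 0

variable {I} in
/-- The rank of the bivector `Λ_x`, i.e. of `Λ^♯_x`, does not depend on the point `x`. -/
def HasConstantRank (Λ : SharpField I P) : Prop :=
  ∃ r : ℕ, ∀ x : P, Module.finrank ℝ (LinearMap.range (Λ x).toLinearMap) = r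

end Basic

/-! ### Maps between Poisson manifolds -/

section Maps

variable {E₁ : Type*} [NormedAddCommGroup E₁] [NormedSpace ℝ E₁]
  {H₁ : Type*} [TopologicalSpace H₁] {I₁ : ModelWithCorners ℝ E₁ H₁}
  {P₁ : Type*} [TopologicalSpace P₁] [ChartedSpace H₁ P₁]
  {E₂ : Type*} [NormedAddCommGroup E₂] [NormedSpace ℝ E₂]
  {H₂ : Type*} [TopologicalSpace H₂] {I₂ : ModelWithCorners ℝ E₂ H₂}
  {P₂ : Type*} [TopologicalSpace P₂] [ChartedSpace H₂ P₂]

/-- A Poisson map: a smooth map with `φ^*{f, g} = {φ^*f, φ^*g}` for all smooth `f, g`. -/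
def IsPoissonMap (Λ₁ : SharpField I₁ P₁) (Λ₂ : SharpField I₂ P₂) (φ : P₁ → P₂) : Prop :=
  ContMDiff I₁ I₂ ∞ φ ∧
    ∀ f g : P₂ → ℝ, ContMDiff I₂ 𝓘(ℝ, ℝ) ∞ f → ContMDiff I₂ 𝓘(ℝ, ℝ) ∞ g →
      ∀ x : P₁, bracket Λ₂ f g (φ x) = bracket Λ₁ (f ∘ φ) (g ∘ φ) x

/-- The bivector field on `P₁ × P₂` which is the sum of those on the factors:
`ξ ↦ (Λ₁^♯ (ξ|_{TP₁}), Λ₂^♯ (ξ|_{TP₂}))`. -/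
def prodField (Λ₁ : SharpField I₁ P₁) (Λ₂ : SharpField I₂ P₂) :
    SharpField (I₁.prod I₂) (P₁ × P₂) := fun p ↦
  let A : (E₁ →L[ℝ] ℝ) →L[ℝ] E₁ := Λ₁ p.1
  let B : (E₂ →L[ℝ] ℝ) →L[ℝ] E₂ := Λ₂ p.2
  show (E₁ × E₂ →L[ℝ] ℝ) →L[ℝ] E₁ × E₂ from
    (A.comp (ContinuousLinearMap.precomp ℝ (ContinuousLinearMap.inl ℝ E₁ E₂))).prod
      (B.comp (ContinuousLinearMap.precomp ℝ (ContinuousLinearMap.inr ℝ E₁ E₂)))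

/-- A smooth embedding of finite-dimensional manifolds: a topological embedding which is a smooth
immersion. -/
structure IsEmbeddedSubmanifold (I₁ : ModelWithCorners ℝ E₁ H₁) (I₂ : ModelWithCorners ℝ E₂ H₂)
    (ι : P₁ → P₂) : Prop where
  isEmbedding : Topology.IsEmbedding ι
  smooth : ContMDiff I₁ I₂ ∞ ι
  immersion : ∀ x, Injective (mfderiv I₁ I₂ ι x)

/-- The tangent space at `ι x` of the submanifold `C = ι(P₁)`. -/
def tangentOf (I₁ : ModelWithCorners ℝ E₁ H₁) (I₂ : ModelWithCorners ℝ E₂ H₂)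
    (ι : P₁ → P₂) (x : P₁) : Submodule ℝ (TangentSpace I₂ (ι x)) :=
  LinearMap.range (mfderiv I₁ I₂ ι x).toLinearMap

/-- The conormal space at `ι x` of the submanifold `C = ι(P₁)`: the covectors that vanish on the
tangent space of `C`. -/
def conormalOf (I₁ : ModelWithCorners ℝ E₁ H₁) (I₂ : ModelWithCorners ℝ E₂ H₂)
    (ι : P₁ → P₂) (x : P₁) : Submodule ℝ (TangentSpace I₂ (ι x) →L[ℝ] ℝ) where
  carrier := {ξ | ∀ v ∈ tangentOf I₁ I₂ ι x, ξ v = 0}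
  add_mem' := fun ha hb v hv ↦ by
    rw [_root_.add_apply, ha v hv, hb v hv, add_zero]
  zero_mem' := fun _ _ ↦ rfl
  smul_mem' := fun c a ha v hv ↦ by
    rw [_root_.smul_apply, ha v hv, smul_zero]

/-- The submanifold `C = ι(P₁)` of `(P₂, Λ)` is pre-Poisson: the rank of `TC + Λ^♯ N^*C` is
constant along `C`. -/
def IsPrePoissonSubmanifold (I₁ : ModelWithCorners ℝ E₁ H₁) (Λ : SharpField I₂ P₂)
    (ι : P₁ → P₂) : Prop :=
  IsEmbeddedSubmanifold I₁ I₂ ι ∧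
    ∃ r : ℕ, ∀ x : P₁, Module.finrank ℝ
      (tangentOf I₁ I₂ ι x ⊔
        (conormalOf I₁ I₂ ι x).map (Λ (ι x)).toLinearMap :
          Submodule ℝ (TangentSpace I₂ (ι x))) = r

/-- `φ` is a pre-Poisson map: its graph, the image of the embedding `x ↦ (x, φ x)`, is a
pre-Poisson submanifold of `(P₁, Λ₁) × (P₂, -Λ₂)`. -/
def IsPrePoissonMap (Λ₁ : SharpField I₁ P₁) (Λ₂ : SharpField I₂ P₂) (φ : P₁ → P₂) : Prop :=
  IsPrePoissonSubmanifold I₁ (prodField Λ₁ (-Λ₂)) (fun x ↦ (x, φ x))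

/-- The push-forward of `Λ₁` by a diffeomorphism: with `x = φ⁻¹(y)`,
`(φ_*Λ₁)^♯_y = d_xφ ∘ (Λ₁^♯)_x ∘ (d_xφ)^*`. The tangent spaces at `φ (φ⁻¹ y)` and at `y` are
identified through `φ (φ⁻¹ y) = y`. -/
def pushforward (φ : P₁ ≃ₘ^∞⟮I₁, I₂⟯ P₂) (Λ₁ : SharpField I₁ P₁) : SharpField I₂ P₂ := fun y ↦
  let dφ : TangentSpace I₁ (φ.symm y) →L[ℝ] TangentSpace I₂ y := mfderiv I₁ I₂ φ (φ.symm y)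
  dφ.comp ((Λ₁ (φ.symm y)).comp (ContinuousLinearMap.precomp ℝ dφ))

end Maps

/-! ### Distributions, integral manifolds, leaf spaces -/

section Distributions

variable {E : Type*} [NormedAddCommGroup E] [NormedSpace ℝ E]
  {H : Type*} [TopologicalSpace H] (I : ModelWithCorners ℝ E H)
  (P : Type*) [TopologicalSpace P] [ChartedSpace H P]

/-- A (possibly singular) distribution: a subspace of each tangent space. -/
abbrev Distribution : Type _ := ∀ x : P, Submodule ℝ (TangentSpace I x)

variable {I P}

/-- `D` is a smooth distribution of constant rank: for some `r`, each point has an open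
neighbourhood with `r` smooth vector fields that form a basis of `D` at each of its points. -/
def IsSmoothConstantRank [IsManifold I ∞ P] (D : Distribution I P) : Prop :=
  ∃ r : ℕ, ∀ x₀ : P, ∃ U : Set P, IsOpen U ∧ x₀ ∈ U ∧
    ∃ X : Fin r → ∀ x : P, TangentSpace I x,
      (∀ i, ContMDiffOn I I.tangent ∞ (fun x ↦ (⟨x, X i x⟩ : TangentBundle I P)) U) ∧
      ∀ x ∈ U, LinearIndependent ℝ (fun i ↦ X i x) ∧
        Submodule.span ℝ (range fun i ↦ X i x) = D x

/-- `ι : U → P` is a parametrized connected integral manifold of `D`, of dimension `k`: an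
injective smooth immersion of a connected open subset of `ℝᵏ` whose tangent spaces are given
by `D`. -/
structure IsIntegralManifold (D : Distribution I P) {k : ℕ} (U : Set (EuclideanSpace ℝ (Fin k)))
    (ι : EuclideanSpace ℝ (Fin k) → P) : Prop where
  isOpen : IsOpen U
  isConnected : IsConnected U
  smooth : ContMDiffOn 𝓘(ℝ, EuclideanSpace ℝ (Fin k)) I ∞ ι U
  injOn : InjOn ι U
  immersion : ∀ u ∈ U, Injective (mfderiv 𝓘(ℝ, EuclideanSpace ℝ (Fin k)) I ι u)
  tangent : ∀ u ∈ U,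
    LinearMap.range (mfderiv 𝓘(ℝ, EuclideanSpace ℝ (Fin k)) I ι u).toLinearMap = D (ι u)

/-- `D` is integrable: each point lies on an integral manifold of `D`. -/
def IsIntegrable (D : Distribution I P) : Prop :=
  ∀ x : P, ∃ (k : ℕ) (U : Set (EuclideanSpace ℝ (Fin k))) (ι : EuclideanSpace ℝ (Fin k) → P),
    IsIntegralManifold D U ι ∧ x ∈ ι '' U

/-- Lying on the same leaf: the equivalence relation generated by lying on a common connected
(parametrized) integral manifold. For integrable `D` its classes are the leaves of `D`, i.e. the
maximal connected integral manifolds. -/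
def leafSetoid (D : Distribution I P) : Setoid P :=
  Relation.EqvGen.setoid fun x y ↦
    ∃ (k : ℕ) (U : Set (EuclideanSpace ℝ (Fin k))) (ι : EuclideanSpace ℝ (Fin k) → P),
      IsIntegralManifold D U ι ∧ x ∈ ι '' U ∧ y ∈ ι '' U

/-- The leaf space `P/D`, with the quotient topology. -/
abbrev LeafSpace (D : Distribution I P) : Type _ := Quotient (leafSetoid D)

/-- The projection `P → P/D`. -/
def leafProj (D : Distribution I P) : P → LeafSpace D := Quotient.mk (leafSetoid D)

/-- A manifold structure on the leaf space is the quotient one: the projection is a smooth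
submersion. (There is at most one such structure.) -/
def IsQuotientSmoothStructure (D : Distribution I P)
    {E₃ : Type*} [NormedAddCommGroup E₃] [NormedSpace ℝ E₃]
    {H₃ : Type*} [TopologicalSpace H₃] (I₃ : ModelWithCorners ℝ E₃ H₃)
    [ChartedSpace H₃ (LeafSpace D)] : Prop :=
  ContMDiff I I₃ ∞ (leafProj D) ∧ ∀ x, Surjective (mfderiv I I₃ (leafProj D) x)

end Distributions

section Deficit

variable {E₁ : Type*} [NormedAddCommGroup E₁] [NormedSpace ℝ E₁]
  {H₁ : Type*} [TopologicalSpace H₁] {I₁ : ModelWithCorners ℝ E₁ H₁}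
  {P₁ : Type*} [TopologicalSpace P₁] [ChartedSpace H₁ P₁]
  {E₂ : Type*} [NormedAddCommGroup E₂] [NormedSpace ℝ E₂]
  {H₂ : Type*} [TopologicalSpace H₂] {I₂ : ModelWithCorners ℝ E₂ H₂}
  {P₂ : Type*} [TopologicalSpace P₂] [ChartedSpace H₂ P₂]

/-- The deficit distribution `D = {(Λ₂ - φ_*Λ₁)^♯ ξ : ξ ∈ T*P₂}` of a diffeomorphism. -/
def deficit (Λ₁ : SharpField I₁ P₁) (Λ₂ : SharpField I₂ P₂) (φ : P₁ ≃ₘ^∞⟮I₁, I₂⟯ P₂) :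
    Distribution I₂ P₂ :=
  fun y ↦ LinearMap.range ((Λ₂ - pushforward φ Λ₁) y).toLinearMap

end Deficit

end PoissonGeometry

end

open Set Function
open scoped Manifold ContDiff Topology

noncomputable section

/-! Write `Δ = Λ₂ - φ_*Λ₁`. With `A = d_xφ`, the conormal covectors of the graph are the pairs `(η ∘
A, -η)`; the product bivector sends them to `(Λ₁(η ∘ A), Λ₂ η)`, which modulo the tangent vectors
`(v, A v)` is `(0, Δ η)`. Hence `TC + Λ^♯N^*C` is isomorphic to `TP₁ ⊕ range Δ`
(`finrank_graph_sup`), and the pre-Poisson condition says exactly that `Δ` has constant rank. `Δ` is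
always a smooth bivector field, and a smooth bivector field of constant rank has a range with local
frames.

For the quotient, pull functions on the leaf space back to `F`, `G` on `P₂`. Their differentials
vanish on `D = range Δ`, so by skewness `Δ dF = Δ dG = 0`: each has the same Hamiltonian field for
`Λ₂` and for `φ_*Λ₁`. Subtracting the two Jacobi identities for `F, G, h` leaves `d{F, G}(Δ dh) = 0`
for every `h` (`differential_bracket_sub_eq_zero`). So `{F, G}` is constant on leaves and the
bracket descends (`IsPoisson.exists_descent`). Since `{F, G}` is the same for both structures, `π ∘
φ` is Poisson as well. -/

namespace PoissonGeometry

/-! ### Bundle sections and differentials in charts -/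

section Charts

open Bundle

variable {E : Type*} [NormedAddCommGroup E] [NormedSpace ℝ E]
  {P : Type*} [TopologicalSpace P] [ChartedSpace E P]

/-- The derivative at `x` of the chart around `x₀`, as a map into the model space. -/
def chartDeriv (x₀ x : P) : TangentSpace 𝓘(ℝ, E) x →L[ℝ] E :=
  mfderiv 𝓘(ℝ, E) 𝓘(ℝ, E) (extChartAt 𝓘(ℝ, E) x₀) x

theorem chartDeriv_eq_continuousLinearMapAt [IsManifold 𝓘(ℝ, E) 1 P] {x₀ x : P}
    (hx : x ∈ (chartAt E x₀).source) :
    chartDeriv x₀ x =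
      (trivializationAt E (TangentSpace 𝓘(ℝ, E)) x₀).continuousLinearMapAt ℝ x :=
  (TangentBundle.continuousLinearMapAt_trivializationAt hx).symm

theorem chartDeriv_bijective [IsManifold 𝓘(ℝ, E) 1 P] {x₀ x : P}
    (hx : x ∈ (chartAt E x₀).source) : Bijective (chartDeriv (E := E) x₀ x) := by
  have h : (mfderiv 𝓘(ℝ, E) 𝓘(ℝ, E) (extChartAt 𝓘(ℝ, E) x₀) x).IsInvertible :=
    isInvertible_mfderiv_extChartAt (by simpa using hx)
  exact h.bijective

/-- The trivialization of the dual bundle precomposes covectors with the inverse of the tangent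
trivialization, so its inverse is pullback along the chart derivative. -/
theorem cotangent_symmL_apply [IsManifold 𝓘(ℝ, E) 1 P] {x₀ x : P}
    (hx : x ∈ (chartAt E x₀).source) (ξ : E →L[ℝ] ℝ) :
    (trivializationAt (E →L[ℝ] ℝ) (fun x : P ↦ TangentSpace 𝓘(ℝ, E) x →L[ℝ] ℝ) x₀).symmL ℝ x ξ
      = ξ.comp (chartDeriv x₀ x) := by
  have hb : x ∈ (trivializationAt E (TangentSpace 𝓘(ℝ, E)) x₀).baseSet := hx
  have hb' : x ∈ (trivializationAt (E →L[ℝ] ℝ)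
      (fun x : P ↦ TangentSpace 𝓘(ℝ, E) x →L[ℝ] ℝ) x₀).baseSet := by
    rw [hom_trivializationAt_baseSet]
    exact ⟨hx, mem_univ _⟩
  have h : (trivializationAt (E →L[ℝ] ℝ)
      (fun x : P ↦ TangentSpace 𝓘(ℝ, E) x →L[ℝ] ℝ) x₀).continuousLinearMapAt ℝ x
      ((trivializationAt (E →L[ℝ] ℝ)
        (fun x : P ↦ TangentSpace 𝓘(ℝ, E) x →L[ℝ] ℝ) x₀).symmL ℝ x ξ) = ξ :=
    Trivialization.continuousLinearMapAt_symmL (R := ℝ) _ hb' ξ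
  rw [Trivialization.continuousLinearMapAt_apply, Trivialization.coe_linearMapAt_of_mem _ hb'] at h
  simp only [hom_trivializationAt_apply, ContinuousLinearMap.inCoordinates] at h
  rw [chartDeriv_eq_continuousLinearMapAt hx]
  refine ContinuousLinearMap.ext fun v ↦ ?_
  nth_rewrite 2 [← h]
  simp only [ContinuousLinearMap.comp_apply]
  rw [Trivialization.symmL_continuousLinearMapAt _ hb]
  simp

/-- The linear map `T*_xP → T_xP` read in the chart at `x₀`. -/
def sharpInChart (Λ : SharpField 𝓘(ℝ, E) P) (x₀ x : P) : (E →L[ℝ] ℝ) →L[ℝ] E :=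
  (chartDeriv x₀ x).comp ((Λ x).comp (ContinuousLinearMap.precomp ℝ (chartDeriv x₀ x)))

theorem sharpInChart_apply (Λ : SharpField 𝓘(ℝ, E) P) (x₀ x : P) (ξ : E →L[ℝ] ℝ) :
    sharpInChart Λ x₀ x ξ = chartDeriv x₀ x (Λ x (ξ.comp (chartDeriv x₀ x))) := rfl

/-- On the chart domain the trivialization of `Hom(T*P, TP)` is given by the chart derivative and
its transpose; this replaces bundle smoothness by smoothness of a map into a fixed vector space. -/
theorem contMDiffAt_sharp_iff [IsManifold 𝓘(ℝ, E) ∞ P] (Λ : SharpField 𝓘(ℝ, E) P) (x₀ : P) :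
    ContMDiffAt 𝓘(ℝ, E) (𝓘(ℝ, E).prod 𝓘(ℝ, (E →L[ℝ] ℝ) →L[ℝ] E)) ∞
    (fun x ↦ Bundle.TotalSpace.mk' ((E →L[ℝ] ℝ) →L[ℝ] E)
      (E := fun x ↦ (TangentSpace 𝓘(ℝ, E) x →L[ℝ] ℝ) →L[ℝ] TangentSpace 𝓘(ℝ, E) x) x (Λ x)) x₀ ↔
    ContMDiffAt 𝓘(ℝ, E) 𝓘(ℝ, (E →L[ℝ] ℝ) →L[ℝ] E) ∞ (sharpInChart Λ x₀) x₀ := by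
  have : IsManifold 𝓘(ℝ, E) 1 P := IsManifold.of_le (n := ∞) (by simp)
  rw [Bundle.contMDiffAt_section]
  apply Filter.EventuallyEq.contMDiffAt_iff
  filter_upwards [(chartAt E x₀).open_source.mem_nhds (mem_chart_source E x₀)] with x hx
  rw [hom_trivializationAt_apply]
  refine ContinuousLinearMap.ext fun ξ ↦ ?_
  simp only [ContinuousLinearMap.inCoordinates, sharpInChart_apply, ContinuousLinearMap.comp_apply]
  rw [chartDeriv_eq_continuousLinearMapAt hx, cotangent_symmL_apply hx,
    chartDeriv_eq_continuousLinearMapAt hx]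

theorem contMDiffAt_vectorField_iff [IsManifold 𝓘(ℝ, E) ∞ P]
    (X : ∀ x : P, TangentSpace 𝓘(ℝ, E) x) (x₀ : P) :
    ContMDiffAt 𝓘(ℝ, E) 𝓘(ℝ, E).tangent ∞ (fun x ↦ (⟨x, X x⟩ : TangentBundle 𝓘(ℝ, E) P)) x₀ ↔
    ContMDiffAt 𝓘(ℝ, E) 𝓘(ℝ, E) ∞ (fun x ↦ chartDeriv x₀ x (X x)) x₀ := by
  have : IsManifold 𝓘(ℝ, E) 1 P := IsManifold.of_le (n := ∞) (by simp)
  rw [Bundle.contMDiffAt_section]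
  apply Filter.EventuallyEq.contMDiffAt_iff
  filter_upwards [(chartAt E x₀).open_source.mem_nhds (mem_chart_source E x₀)] with x hx
  rw [chartDeriv_eq_continuousLinearMapAt hx,
    Trivialization.continuousLinearMapAt_apply, Trivialization.coe_linearMapAt_of_mem _ hx]

/-- The derivative at `x` of the expression of `f` in the chart around `x₀`. -/
def differentialInChart (f : P → ℝ) (x₀ x : P) : E →L[ℝ] ℝ :=
  fderiv ℝ (f ∘ (extChartAt 𝓘(ℝ, E) x₀).symm) (extChartAt 𝓘(ℝ, E) x₀ x)

theorem differential_eq_comp_chartDeriv [IsManifold 𝓘(ℝ, E) 1 P] {x₀ x : P}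
    (hx : x ∈ (chartAt E x₀).source) {f : P → ℝ} (hf : MDifferentiableAt 𝓘(ℝ, E) 𝓘(ℝ, ℝ) f x) :
    differential 𝓘(ℝ, E) f x = (differentialInChart f x₀ x).comp (chartDeriv x₀ x) := by
  have hx' : x ∈ (extChartAt 𝓘(ℝ, E) x₀).source := by simpa using hx
  have hsymm : MDifferentiableAt 𝓘(ℝ, E) 𝓘(ℝ, E) (extChartAt 𝓘(ℝ, E) x₀).symm
      (extChartAt 𝓘(ℝ, E) x₀ x) := by
    have := mdifferentiableWithinAt_extChartAt_symm (I := 𝓘(ℝ, E))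
      ((extChartAt 𝓘(ℝ, E) x₀).map_source hx')
    rwa [modelWithCornersSelf_coe, range_id, mdifferentiableWithinAt_univ] at this
  have hfs : MDifferentiableAt 𝓘(ℝ, E) 𝓘(ℝ, ℝ) (f ∘ (extChartAt 𝓘(ℝ, E) x₀).symm)
      (extChartAt 𝓘(ℝ, E) x₀ x) := by
    refine MDifferentiableAt.comp _ ?_ hsymm
    rwa [(extChartAt 𝓘(ℝ, E) x₀).left_inv hx']
  have hA := mdifferentiableAt_extChartAt (I := 𝓘(ℝ, E)) hx
  have heq : f =ᶠ[𝓝 x] (f ∘ (extChartAt 𝓘(ℝ, E) x₀).symm) ∘ extChartAt 𝓘(ℝ, E) x₀ := by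
    filter_upwards [(chartAt E x₀).open_source.mem_nhds hx] with y hy
    simp only [comp_apply]
    rw [(extChartAt 𝓘(ℝ, E) x₀).left_inv (by simpa using hy)]
  have h1 := heq.mfderiv_eq (I := 𝓘(ℝ, E)) (I' := 𝓘(ℝ, ℝ))
  rw [mfderiv_comp x hfs hA, mfderiv_eq_fderiv] at h1
  exact h1

theorem contMDiffAt_differentialInChart [IsManifold 𝓘(ℝ, E) ∞ P] (x₀ : P) {f : P → ℝ}
    (hf : ContMDiffAt 𝓘(ℝ, E) 𝓘(ℝ, ℝ) ∞ f x₀) :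
    ContMDiffAt 𝓘(ℝ, E) 𝓘(ℝ, E →L[ℝ] ℝ) ∞ (differentialInChart (E := E) f x₀) x₀ := by
  have h1 : ContDiffAt ℝ ∞ (f ∘ (extChartAt 𝓘(ℝ, E) x₀).symm) (extChartAt 𝓘(ℝ, E) x₀ x₀) := by
    have := (contMDiffAt_iff.1 hf).2
    rwa [modelWithCornersSelf_coe, range_id, contDiffWithinAt_univ, extChartAt_model_space_eq_id]
      at this
  have h2 := (h1.fderiv_right (m := ∞) (by simp)).contMDiffAt
  exact h2.comp x₀ contMDiffAt_extChartAt

end Charts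

/-! ### Brackets detect bivector fields -/

section Criterion

variable {E : Type*} [NormedAddCommGroup E] [NormedSpace ℝ E]
  {P : Type*} [TopologicalSpace P] [ChartedSpace E P]

theorem contMDiff_sharp_differential [IsManifold 𝓘(ℝ, E) ∞ P] {Λ : SharpField 𝓘(ℝ, E) P}
    (hΛ : IsBivectorField Λ) {f : P → ℝ} (hf : ContMDiff 𝓘(ℝ, E) 𝓘(ℝ, ℝ) ∞ f) :
    ContMDiff 𝓘(ℝ, E) 𝓘(ℝ, E).tangent ∞
      (fun x ↦ (⟨x, Λ x (differential 𝓘(ℝ, E) f x)⟩ : TangentBundle 𝓘(ℝ, E) P)) := by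
  have : IsManifold 𝓘(ℝ, E) 1 P := IsManifold.of_le (n := ∞) (by simp)
  intro x₀
  rw [contMDiffAt_vectorField_iff]
  refine (((contMDiffAt_sharp_iff Λ x₀).1 (hΛ.smooth x₀)).clm_apply
    (contMDiffAt_differentialInChart x₀ (hf x₀))).congr_of_eventuallyEq ?_
  filter_upwards [(chartAt E x₀).open_source.mem_nhds (mem_chart_source E x₀)] with x hx
  rw [sharpInChart_apply, ← differential_eq_comp_chartDeriv hx (hf.mdifferentiable (by simp) x)]

theorem contMDiff_bracket [IsManifold 𝓘(ℝ, E) ∞ P] {Λ : SharpField 𝓘(ℝ, E) P}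
    (hΛ : IsBivectorField Λ) {f g : P → ℝ} (hf : ContMDiff 𝓘(ℝ, E) 𝓘(ℝ, ℝ) ∞ f)
    (hg : ContMDiff 𝓘(ℝ, E) 𝓘(ℝ, ℝ) ∞ g) :
    ContMDiff 𝓘(ℝ, E) 𝓘(ℝ, ℝ) ∞ (bracket Λ f g) := by
  have : IsManifold 𝓘(ℝ, E) 1 P := IsManifold.of_le (n := ∞) (by simp)
  intro x₀
  refine ((contMDiffAt_differentialInChart x₀ (hf x₀)).clm_apply
    (((contMDiffAt_sharp_iff Λ x₀).1 (hΛ.smooth x₀)).clm_apply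
    (contMDiffAt_differentialInChart x₀ (hg x₀)))).congr_of_eventuallyEq ?_
  filter_upwards [(chartAt E x₀).open_source.mem_nhds (mem_chart_source E x₀)] with x hx
  rw [sharpInChart_apply, ← differential_eq_comp_chartDeriv hx (hg.mdifferentiable (by simp) x),
    bracket, differential_eq_comp_chartDeriv hx (hf.mdifferentiable (by simp) x),
    ContinuousLinearMap.comp_apply]

/-- A smooth function that is linear with given derivative in the chart around a point. -/
theorem exists_eventually_differential_eq [FiniteDimensional ℝ E] [T2Space P]
    [IsManifold 𝓘(ℝ, E) ∞ P] (x₀ : P) (η : E →L[ℝ] ℝ) :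
    ∃ f : P → ℝ, ContMDiff 𝓘(ℝ, E) 𝓘(ℝ, ℝ) ∞ f ∧
      ∀ᶠ x in 𝓝 x₀, differential 𝓘(ℝ, E) f x = η.comp (chartDeriv x₀ x) := by
  have : IsManifold 𝓘(ℝ, E) 1 P := IsManifold.of_le (n := ∞) (by simp)
  obtain ⟨χ⟩ : Nonempty (SmoothBumpFunction 𝓘(ℝ, E) x₀) := inferInstance
  -- The bump function makes the local linear function globally smooth and is `1` near `x₀`, so the
  -- differential is unaffected there.
  refine ⟨fun x ↦ χ x • η (extChartAt 𝓘(ℝ, E) x₀ x), χ.contMDiff_smul ?_, ?_⟩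
  · exact η.contMDiff.comp_contMDiffOn contMDiffOn_extChartAt
  filter_upwards [(chartAt E x₀).open_source.mem_nhds (mem_chart_source E x₀),
    χ.eventuallyEq_one.eventuallyEq_nhds] with x hx hχ
  have heq : (fun x ↦ χ x • η (extChartAt 𝓘(ℝ, E) x₀ x)) =ᶠ[𝓝 x]
      η ∘ extChartAt 𝓘(ℝ, E) x₀ := by
    filter_upwards [hχ] with y hy
    simp [hy]
  have h1 := heq.mfderiv_eq (I := 𝓘(ℝ, E)) (I' := 𝓘(ℝ, ℝ))
  rw [mfderiv_comp (I' := 𝓘(ℝ, E)) x η.differentiableAt.mdifferentiableAt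
    (mdifferentiableAt_extChartAt (I := 𝓘(ℝ, E)) hx), mfderiv_eq_fderiv,
    ContinuousLinearMap.fderiv] at h1
  exact h1

/-- Lets pointwise identities in covectors be checked on differentials of global smooth functions,
i.e. on brackets. -/
theorem exists_differential_eq [FiniteDimensional ℝ E] [T2Space P]
    [IsManifold 𝓘(ℝ, E) ∞ P] (x : P) (ξ : TangentSpace 𝓘(ℝ, E) x →L[ℝ] ℝ) :
    ∃ f : P → ℝ, ContMDiff 𝓘(ℝ, E) 𝓘(ℝ, ℝ) ∞ f ∧ differential 𝓘(ℝ, E) f x = ξ := by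
  have : IsManifold 𝓘(ℝ, E) 1 P := IsManifold.of_le (n := ∞) (by simp)
  have hinv : (chartDeriv (E := E) x x).IsInvertible :=
    isInvertible_mfderiv_extChartAt (mem_extChartAt_source x)
  obtain ⟨e, he⟩ := hinv
  obtain ⟨f, hf, hfx⟩ := exists_eventually_differential_eq x (ξ.comp e.symm.toContinuousLinearMap)
  refine ⟨f, hf, ?_⟩
  rw [hfx.self_of_nhds, ← he]
  refine ContinuousLinearMap.ext fun v ↦ ?_
  simp

/-- Jointly injective functionals have a linear left inverse, which recovers `h` from its smooth
coordinates. -/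
theorem contMDiffAt_of_injective_pi {F : Type*} [NormedAddCommGroup F] [NormedSpace ℝ F]
    [FiniteDimensional ℝ F] {ι : Type*} [Fintype ι] (l : ι → F →ₗ[ℝ] ℝ)
    (hl : ∀ v, (∀ i, l i v = 0) → v = 0) {h : P → F} {x : P}
    (hh : ∀ i, ContMDiffAt 𝓘(ℝ, E) 𝓘(ℝ, ℝ) ∞ (fun y ↦ l i (h y)) x) :
    ContMDiffAt 𝓘(ℝ, E) 𝓘(ℝ, F) ∞ h x := by
  obtain ⟨r, hr⟩ := (LinearMap.pi l).exists_leftInverse_of_injective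
    (LinearMap.ker_eq_bot'.2 fun v hv ↦ hl v fun i ↦ congrFun hv i)
  have h1 : ContMDiffAt 𝓘(ℝ, E) 𝓘(ℝ, ι → ℝ) ∞ (fun y i ↦ l i (h y)) x :=
    contMDiffAt_pi_space.2 hh
  refine ((LinearMap.toContinuousLinearMap r).contMDiff.contMDiffAt.comp x h1).congr_of_eventuallyEq
    (Filter.Eventually.of_forall fun y ↦ ?_)
  exact (LinearMap.congr_fun hr (h y)).symm

/-- In a chart the matrix entries of `Λ` are locally brackets of functions that are linear in that
chart. Constructed fields are thereby handled through brackets alone. -/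
theorem isBivectorField_of_bracket [FiniteDimensional ℝ E] [T2Space P]
    [IsManifold 𝓘(ℝ, E) ∞ P] {Λ : SharpField 𝓘(ℝ, E) P}
    (hskew : ∀ f g : P → ℝ, ContMDiff 𝓘(ℝ, E) 𝓘(ℝ, ℝ) ∞ f → ContMDiff 𝓘(ℝ, E) 𝓘(ℝ, ℝ) ∞ g →
      ∀ x, bracket Λ f g x = - bracket Λ g f x)
    (hsmooth : ∀ f g : P → ℝ, ContMDiff 𝓘(ℝ, E) 𝓘(ℝ, ℝ) ∞ f →
      ContMDiff 𝓘(ℝ, E) 𝓘(ℝ, ℝ) ∞ g → ContMDiff 𝓘(ℝ, E) 𝓘(ℝ, ℝ) ∞ (bracket Λ f g)) :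
    IsBivectorField Λ := by
  refine ⟨fun x ξ η ↦ ?_, fun x₀ ↦ ?_⟩
  · obtain ⟨f, hf, rfl⟩ := exists_differential_eq x ξ
    obtain ⟨g, hg, rfl⟩ := exists_differential_eq x η
    exact hskew g f hg hf x
  rw [contMDiffAt_sharp_iff]
  let b := Module.finBasis ℝ (E →L[ℝ] ℝ)
  refine contMDiffAt_of_injective_pi
    (l := fun (i : Fin _ × Fin _) ↦ (b i.1).toLinearMap ∘ₗ
      (ContinuousLinearMap.apply ℝ E (b i.2)).toLinearMap) ?_ ?_
  · intro T hT
    have h1 : ∀ i, T (b i) = 0 := fun i ↦ by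
      -- All covectors in the basis `b` vanish on `T (b i)`, hence so does every covector, and
      -- covectors separate points.
      by_contra hne
      obtain ⟨g, hg⟩ := SeparatingDual.exists_ne_zero (R := ℝ) hne
      apply hg
      have h2 : (ContinuousLinearMap.apply ℝ ℝ (T (b i))).toLinearMap = 0 :=
        b.ext fun j ↦ hT (j, i)
      exact LinearMap.congr_fun h2 g
    have h3 : T.toLinearMap = 0 := b.ext h1
    exact ContinuousLinearMap.ext fun v ↦ LinearMap.congr_fun h3 v
  · rintro ⟨i, j⟩
    obtain ⟨f, hf, hfx⟩ := exists_eventually_differential_eq x₀ (b i)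
    obtain ⟨g, hg, hgx⟩ := exists_eventually_differential_eq x₀ (b j)
    refine (hsmooth f g hf hg x₀).congr_of_eventuallyEq ?_
    filter_upwards [hfx, hgx] with x h1 h2
    rw [bracket, h1, h2]
    rfl

theorem sharpField_ext [FiniteDimensional ℝ E] [T2Space P] [IsManifold 𝓘(ℝ, E) ∞ P]
    {Λ Λ' : SharpField 𝓘(ℝ, E) P}
    (h : ∀ f g : P → ℝ, ContMDiff 𝓘(ℝ, E) 𝓘(ℝ, ℝ) ∞ f → ContMDiff 𝓘(ℝ, E) 𝓘(ℝ, ℝ) ∞ g →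
      ∀ x, bracket Λ f g x = bracket Λ' f g x) : Λ = Λ' := by
  funext x
  refine ContinuousLinearMap.ext fun ξ ↦ ?_
  by_contra hne
  obtain ⟨η, hη⟩ : ∃ η : E →L[ℝ] ℝ, η ((Λ x ξ : E) - (Λ' x ξ : E)) ≠ 0 :=
    SeparatingDual.exists_ne_zero (R := ℝ) (sub_ne_zero.2 hne)
  obtain ⟨f, hf, hfx⟩ := exists_differential_eq (E := E) x η
  obtain ⟨g, hg, hgx⟩ := exists_differential_eq x ξ
  have h1 := h f g hf hg x
  rw [bracket, bracket, hfx, hgx] at h1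
  exact hη ((η.map_sub _ _).trans (sub_eq_zero.2 h1))

end Criterion
-- Push-forward of Poisson structures
section Push

variable {E₁ : Type*} [NormedAddCommGroup E₁] [NormedSpace ℝ E₁]
  {P₁ : Type*} [TopologicalSpace P₁] [ChartedSpace E₁ P₁]
  {E₂ : Type*} [NormedAddCommGroup E₂] [NormedSpace ℝ E₂]
  {P₂ : Type*} [TopologicalSpace P₂] [ChartedSpace E₂ P₂]

/-- The derivative of `φ` at `x` as a map into the tangent space at a point `y` equal to `φ x`. -/
def derivTo (φ : P₁ → P₂) (x : P₁) (y : P₂) :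
    TangentSpace 𝓘(ℝ, E₁) x →L[ℝ] TangentSpace 𝓘(ℝ, E₂) y :=
  mfderiv 𝓘(ℝ, E₁) 𝓘(ℝ, E₂) φ x

theorem differential_comp {φ : P₁ → P₂} {x : P₁} {y : P₂} (h : φ x = y)
    (hφ : MDifferentiableAt 𝓘(ℝ, E₁) 𝓘(ℝ, E₂) φ x) {f : P₂ → ℝ}
    (hf : MDifferentiableAt 𝓘(ℝ, E₂) 𝓘(ℝ, ℝ) f y) :
    differential 𝓘(ℝ, E₁) (f ∘ φ) x = (differential 𝓘(ℝ, E₂) f y).comp (derivTo φ x y) := by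
  subst h
  exact mfderiv_comp x hf hφ

/-- The image of the bivector `Λ_x` under the derivative of `φ` at `x`. -/
def pushAt (Λ : SharpField 𝓘(ℝ, E₁) P₁) (φ : P₁ → P₂) (x : P₁) (y : P₂) :
    (TangentSpace 𝓘(ℝ, E₂) y →L[ℝ] ℝ) →L[ℝ] TangentSpace 𝓘(ℝ, E₂) y :=
  (derivTo φ x y).comp ((Λ x).comp (ContinuousLinearMap.precomp ℝ (derivTo φ x y)))

/-- The chain rule in both arguments. Keeping `y` apart from `φ x` avoids transport between tangent
spaces when `x` is a chosen preimage of `y`. -/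
theorem differential_pushAt (Λ : SharpField 𝓘(ℝ, E₁) P₁) {φ : P₁ → P₂} {x : P₁} {y : P₂}
    (h : φ x = y) (hφ : MDifferentiableAt 𝓘(ℝ, E₁) 𝓘(ℝ, E₂) φ x) {f g : P₂ → ℝ}
    (hf : MDifferentiableAt 𝓘(ℝ, E₂) 𝓘(ℝ, ℝ) f y) (hg : MDifferentiableAt 𝓘(ℝ, E₂) 𝓘(ℝ, ℝ) g y) :
    differential 𝓘(ℝ, E₂) f y (pushAt Λ φ x y (differential 𝓘(ℝ, E₂) g y)) =
      bracket Λ (f ∘ φ) (g ∘ φ) x := by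
  rw [bracket, differential_comp h hφ hf, differential_comp h hφ hg]
  rfl

theorem pushforward_eq_pushAt (Λ : SharpField 𝓘(ℝ, E₁) P₁)
    (φ : P₁ ≃ₘ^∞⟮𝓘(ℝ, E₁), 𝓘(ℝ, E₂)⟯ P₂) {x : P₁} {y : P₂} (h : φ x = y) :
    pushforward φ Λ y = pushAt Λ φ x y := by
  obtain rfl : x = φ.symm y := by rw [← h, φ.symm_apply_apply]
  rfl

theorem bracket_pushforward (Λ : SharpField 𝓘(ℝ, E₁) P₁)
    (φ : P₁ ≃ₘ^∞⟮𝓘(ℝ, E₁), 𝓘(ℝ, E₂)⟯ P₂) {f g : P₂ → ℝ}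
    (hf : ContMDiff 𝓘(ℝ, E₂) 𝓘(ℝ, ℝ) ∞ f) (hg : ContMDiff 𝓘(ℝ, E₂) 𝓘(ℝ, ℝ) ∞ g) (x : P₁) :
    bracket (pushforward φ Λ) f g (φ x) = bracket Λ (f ∘ φ) (g ∘ φ) x := by
  rw [bracket, pushforward_eq_pushAt Λ φ rfl]
  exact differential_pushAt Λ rfl (φ.contMDiff.mdifferentiable (by simp) x)
    (hf.mdifferentiable (by simp) _) (hg.mdifferentiable (by simp) _)

theorem IsBivectorField.bracket_skew {Λ : SharpField 𝓘(ℝ, E₁) P₁} [IsManifold 𝓘(ℝ, E₁) ∞ P₁]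
    (hΛ : IsBivectorField Λ) (f g : P₁ → ℝ) (x : P₁) : bracket Λ f g x = - bracket Λ g f x :=
  hΛ.skew x _ _

variable [FiniteDimensional ℝ E₂] [T2Space P₂] [IsManifold 𝓘(ℝ, E₁) ∞ P₁]
  [IsManifold 𝓘(ℝ, E₂) ∞ P₂]

theorem IsBivectorField.pushforward {Λ : SharpField 𝓘(ℝ, E₁) P₁} (hΛ : IsBivectorField Λ)
    (φ : P₁ ≃ₘ^∞⟮𝓘(ℝ, E₁), 𝓘(ℝ, E₂)⟯ P₂) : IsBivectorField (pushforward φ Λ) := by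
  refine isBivectorField_of_bracket (fun f g hf hg y ↦ ?_) fun f g hf hg ↦ ?_
  · obtain ⟨x, rfl⟩ : ∃ x, φ x = y := ⟨φ.symm y, φ.apply_symm_apply y⟩
    rw [bracket_pushforward Λ φ hf hg, bracket_pushforward Λ φ hg hf, hΛ.bracket_skew]
  · have h : bracket (PoissonGeometry.pushforward φ Λ) f g =
        bracket Λ (f ∘ φ) (g ∘ φ) ∘ φ.symm := by
      funext y
      obtain ⟨x, rfl⟩ : ∃ x, φ x = y := ⟨φ.symm y, φ.apply_symm_apply y⟩
      rw [bracket_pushforward Λ φ hf hg, comp_apply, φ.symm_apply_apply]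
    rw [h]
    exact (contMDiff_bracket hΛ (hf.comp φ.contMDiff) (hg.comp φ.contMDiff)).comp φ.symm.contMDiff

theorem IsPoisson.pushforward {Λ : SharpField 𝓘(ℝ, E₁) P₁} (hΛ : IsPoisson Λ)
    (φ : P₁ ≃ₘ^∞⟮𝓘(ℝ, E₁), 𝓘(ℝ, E₂)⟯ P₂) : IsPoisson (pushforward φ Λ) := by
  have hB := hΛ.toIsBivectorField.pushforward φ
  refine ⟨hB, fun f g h hf hg hh y ↦ ?_⟩
  obtain ⟨x, rfl⟩ : ∃ x, φ x = y := ⟨φ.symm y, φ.apply_symm_apply y⟩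
  have key : ∀ {f g : P₂ → ℝ}, ContMDiff 𝓘(ℝ, E₂) 𝓘(ℝ, ℝ) ∞ f → ContMDiff 𝓘(ℝ, E₂) 𝓘(ℝ, ℝ) ∞ g →
      bracket (PoissonGeometry.pushforward φ Λ) f g ∘ φ = bracket Λ (f ∘ φ) (g ∘ φ) :=
    fun hf hg ↦ funext fun x ↦ bracket_pushforward Λ φ hf hg x
  rw [bracket_pushforward Λ φ hf (contMDiff_bracket hB hg hh),
    bracket_pushforward Λ φ hg (contMDiff_bracket hB hh hf),
    bracket_pushforward Λ φ hh (contMDiff_bracket hB hf hg), key hg hh, key hh hf, key hf hg]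
  exact hΛ.jacobi _ _ _ (hf.comp φ.contMDiff) (hg.comp φ.contMDiff) (hh.comp φ.contMDiff) x

theorem IsBivectorField.sub {Λ Λ' : SharpField 𝓘(ℝ, E₂) P₂} (hΛ : IsBivectorField Λ)
    (hΛ' : IsBivectorField Λ') : IsBivectorField (Λ - Λ') := by
  have key : ∀ f g : P₂ → ℝ, bracket (Λ - Λ') f g = bracket Λ f g - bracket Λ' f g :=
    fun f g ↦ funext fun x ↦ map_sub (differential 𝓘(ℝ, E₂) f x) _ _
  refine isBivectorField_of_bracket (fun f g hf hg y ↦ ?_) fun f g hf hg ↦ ?_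
  · rw [key, key, Pi.sub_apply, Pi.sub_apply, hΛ.bracket_skew, hΛ'.bracket_skew]
    ring
  · rw [key]
    exact (contMDiff_bracket hΛ hf hg).sub (contMDiff_bracket hΛ' hf hg)

end Push

/-! ### The rank along the graph -/

section Graph

/-- The shear `(v, d) ↦ (v, A v + d)` is injective and carries `E₁ × range Δ` onto `C + L K`. -/
theorem finrank_graph_sup {E₁ E₂ : Type*} [NormedAddCommGroup E₁] [NormedSpace ℝ E₁]
    [NormedAddCommGroup E₂] [NormedSpace ℝ E₂] [FiniteDimensional ℝ E₁] [FiniteDimensional ℝ E₂]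
    (A : E₁ →L[ℝ] E₂) (L₁ : (E₁ →L[ℝ] ℝ) →L[ℝ] E₁) (L₂ : (E₂ →L[ℝ] ℝ) →L[ℝ] E₂)
    (C : Submodule ℝ (E₁ × E₂)) (hC : ∀ p, p ∈ C ↔ p.2 = A p.1)
    (K : Submodule ℝ (E₁ × E₂ →L[ℝ] ℝ)) (hK : ∀ ξ, ξ ∈ K ↔ ∀ v ∈ C, ξ v = 0)
    (L : (E₁ × E₂ →L[ℝ] ℝ) →ₗ[ℝ] E₁ × E₂)
    (hL : ∀ ξ, L ξ = (L₁ (ξ.comp (ContinuousLinearMap.inl ℝ E₁ E₂)),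
      -L₂ (ξ.comp (ContinuousLinearMap.inr ℝ E₁ E₂)))) :
    Module.finrank ℝ (C ⊔ K.map L : Submodule ℝ (E₁ × E₂)) = Module.finrank ℝ E₁ +
      Module.finrank ℝ (LinearMap.range
        (L₂ - A.comp (L₁.comp (ContinuousLinearMap.precomp ℝ A))).toLinearMap) := by
  set Δ := L₂ - A.comp (L₁.comp (ContinuousLinearMap.precomp ℝ A)) with hΔ
  have hΔ' : ∀ η, Δ η = L₂ η - A (L₁ (η.comp A)) := fun η ↦ rfl
  let D := LinearMap.range Δ.toLinearMap
  let T : E₁ × D →ₗ[ℝ] E₁ × E₂ :=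
    (LinearMap.fst ℝ E₁ D).prod (A.toLinearMap ∘ₗ LinearMap.fst ℝ E₁ D +
      D.subtype ∘ₗ LinearMap.snd ℝ E₁ D)
  have hT : ∀ v d, T (v, d) = (v, A v + d) := fun v d ↦ rfl
  have hinj : Injective T := by
    rintro ⟨v, d⟩ ⟨v', d'⟩ h
    rw [hT, hT, Prod.mk.injEq] at h
    obtain ⟨rfl, h⟩ := h
    rw [Subtype.ext (add_left_cancel h)]
  have hrange : C ⊔ K.map L = LinearMap.range T := by
    apply le_antisymm
    · refine sup_le (fun p hp ↦ ⟨(p.1, 0), ?_⟩) ?_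
      · rw [hT, Submodule.coe_zero, add_zero, ← (hC p).1 hp]
      · rintro _ ⟨ξ, hξ, rfl⟩
        set η := ξ.comp (ContinuousLinearMap.inr ℝ E₁ E₂) with hη
        have h1 : ξ.comp (ContinuousLinearMap.inl ℝ E₁ E₂) = -(η.comp A) := by
          refine ContinuousLinearMap.ext fun v ↦ ?_
          have h2 := (hK ξ).1 hξ (v, A v) ((hC _).2 rfl)
          have h3 : ((v, A v) : E₁ × E₂) = (v, 0) + (0, A v) := by simp
          rw [h3, map_add] at h2
          exact eq_neg_of_add_eq_zero_left h2
        -- Here `ξ = (-η ∘ A, η)`, so `L ξ = (-L₁(η ∘ A), -L₂ η)`; subtracting `A` of the first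
        -- component from the second leaves `Δ (-η)`.
        refine ⟨(-L₁ (η.comp A), ⟨Δ (-η), -η, rfl⟩), ?_⟩
        rw [hT, hL, h1, ← hη]
        change (-L₁ (η.comp A), A (-L₁ (η.comp A)) + Δ (-η)) = _
        rw [map_neg, map_neg, map_neg, hΔ']
        simp only [Prod.mk.injEq, true_and]
        abel
    · rintro _ ⟨⟨v, ⟨_, η, rfl⟩⟩, rfl⟩
      -- This conormal covector has image `(L₁(η ∘ A), L₂ η)`, which differs from `(0, Δ η)` by a
      -- vector of the graph.
      let ξ : E₁ × E₂ →L[ℝ] ℝ := ContinuousLinearMap.coprod (η.comp A) (-η)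
      have hξ : ξ ∈ K := (hK ξ).2 fun p hp ↦ by
        change η (A p.1) + -(η p.2) = 0
        rw [(hC p).1 hp, add_neg_cancel]
      have h1 : ξ.comp (ContinuousLinearMap.inl ℝ E₁ E₂) = η.comp A :=
        ContinuousLinearMap.ext fun v ↦ by simp [ξ]
      have h2 : ξ.comp (ContinuousLinearMap.inr ℝ E₁ E₂) = -η :=
        ContinuousLinearMap.ext fun v ↦ by simp [ξ]
      have h3 : T (v, ⟨Δ.toLinearMap η, η, rfl⟩) =
          (v - L₁ (η.comp A), A (v - L₁ (η.comp A))) + L ξ := by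
        rw [hL, h1, h2, hT]
        change (v, A v + Δ η) = _
        rw [hΔ', map_neg, neg_neg, map_sub, Prod.mk_add_mk, sub_add_cancel]
        simp only [Prod.mk.injEq, true_and]
        abel
      rw [h3]
      exact Submodule.add_mem_sup ((hC _).2 rfl) ⟨ξ, hξ, rfl⟩
  rw [hrange, LinearMap.finrank_range_of_inj hinj, Module.finrank_prod]

variable {E₁ : Type*} [NormedAddCommGroup E₁] [NormedSpace ℝ E₁]
  {P₁ : Type*} [TopologicalSpace P₁] [ChartedSpace E₁ P₁]
  {E₂ : Type*} [NormedAddCommGroup E₂] [NormedSpace ℝ E₂]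
  {P₂ : Type*} [TopologicalSpace P₂] [ChartedSpace E₂ P₂]

theorem mfderiv_graph_apply {φ : P₁ → P₂} {x : P₁}
    (hφ : MDifferentiableAt 𝓘(ℝ, E₁) 𝓘(ℝ, E₂) φ x) (v : TangentSpace 𝓘(ℝ, E₁) x) :
    (mfderiv 𝓘(ℝ, E₁) (𝓘(ℝ, E₁).prod 𝓘(ℝ, E₂)) (fun x ↦ (x, φ x)) x v : E₁ × E₂) =
      (v, derivTo φ x (φ x) v) := by
  have h := mfderiv_prodMk (I := 𝓘(ℝ, E₁)) (I' := 𝓘(ℝ, E₁)) (I'' := 𝓘(ℝ, E₂))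
    (mdifferentiableAt_id (x := x)) hφ
  rw [mfderiv_id] at h
  exact DFunLike.congr_fun h v

theorem isEmbeddedSubmanifold_graph {φ : P₁ → P₂} (hφ : ContMDiff 𝓘(ℝ, E₁) 𝓘(ℝ, E₂) ∞ φ) :
    IsEmbeddedSubmanifold 𝓘(ℝ, E₁) (𝓘(ℝ, E₁).prod 𝓘(ℝ, E₂)) (fun x ↦ (x, φ x)) where
  isEmbedding := isEmbedding_graph hφ.continuous
  smooth := contMDiff_id.prodMk hφ
  immersion x v w h := by
    have h1 := (mfderiv_graph_apply (hφ.mdifferentiable (by simp) x) v).symm.trans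
      (Eq.trans h (mfderiv_graph_apply (hφ.mdifferentiable (by simp) x) w))
    exact congrArg Prod.fst h1

theorem finrank_graph [FiniteDimensional ℝ E₁] [FiniteDimensional ℝ E₂]
    (Λ₁ : SharpField 𝓘(ℝ, E₁) P₁) (Λ₂ : SharpField 𝓘(ℝ, E₂) P₂)
    (φ : P₁ ≃ₘ^∞⟮𝓘(ℝ, E₁), 𝓘(ℝ, E₂)⟯ P₂) (x : P₁) :
    Module.finrank ℝ
      (tangentOf 𝓘(ℝ, E₁) (𝓘(ℝ, E₁).prod 𝓘(ℝ, E₂)) (fun x ↦ (x, φ x)) x ⊔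
        (conormalOf 𝓘(ℝ, E₁) (𝓘(ℝ, E₁).prod 𝓘(ℝ, E₂)) (fun x ↦ (x, φ x)) x).map
          (prodField Λ₁ (-Λ₂) (x, φ x)).toLinearMap :
          Submodule ℝ (TangentSpace (𝓘(ℝ, E₁).prod 𝓘(ℝ, E₂)) (x, φ x))) =
      Module.finrank ℝ E₁ +
        Module.finrank ℝ (LinearMap.range ((Λ₂ - pushforward φ Λ₁) (φ x)).toLinearMap) := by
  have hφ := φ.contMDiff.mdifferentiable (by simp) x
  have hΔ : (Λ₂ - pushforward φ Λ₁) (φ x) = Λ₂ (φ x) - pushAt Λ₁ φ x (φ x) := by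
    rw [Pi.sub_apply, pushforward_eq_pushAt Λ₁ φ rfl]
  rw [hΔ]
  refine finrank_graph_sup (E₁ := E₁) (E₂ := E₂) (derivTo φ x (φ x)) (Λ₁ x) (Λ₂ (φ x)) _ (fun p ↦ ?_) _
    (fun ξ ↦ Iff.rfl) _ (fun ξ ↦ rfl)
  constructor
  · rintro ⟨v, rfl⟩
    have h := mfderiv_graph_apply hφ v
    exact (congrArg Prod.snd h).trans
      (congrArg (fun p : E₁ × E₂ ↦ (derivTo φ x (φ x) p.1 : E₂)) h).symm
  · intro h
    exact ⟨p.1, (mfderiv_graph_apply hφ p.1).trans (Prod.ext rfl h.symm)⟩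

theorem isPrePoissonMap_iff_hasConstantRank [FiniteDimensional ℝ E₁] [FiniteDimensional ℝ E₂]
    (Λ₁ : SharpField 𝓘(ℝ, E₁) P₁)
    (Λ₂ : SharpField 𝓘(ℝ, E₂) P₂) (φ : P₁ ≃ₘ^∞⟮𝓘(ℝ, E₁), 𝓘(ℝ, E₂)⟯ P₂) :
    IsPrePoissonMap Λ₁ Λ₂ φ ↔ HasConstantRank (Λ₂ - pushforward φ Λ₁) := by
  constructor
  · rintro ⟨-, r, hr⟩
    -- At every point `r` is `finrank E₁` plus the rank of the difference, so the truncated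
    -- subtraction loses nothing.
    refine ⟨r - Module.finrank ℝ E₁, fun y ↦ ?_⟩
    obtain ⟨x, rfl⟩ : ∃ x, φ x = y := ⟨φ.symm y, φ.apply_symm_apply y⟩
    have h := (finrank_graph Λ₁ Λ₂ φ x).symm.trans (hr x)
    omega
  · rintro ⟨r, hr⟩
    refine ⟨isEmbeddedSubmanifold_graph φ.contMDiff, Module.finrank ℝ E₁ + r, fun x ↦ ?_⟩
    exact (finrank_graph Λ₁ Λ₂ φ x).trans (by rw [hr])

end Graph

/-! ### Constant rank and local frames -/

section Frame

theorem exists_linearIndependent_apply {V W : Type*} [AddCommGroup V] [Module ℝ V]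
    [AddCommGroup W] [Module ℝ W] [FiniteDimensional ℝ W] (T : V →ₗ[ℝ] W) {r : ℕ}
    (hr : Module.finrank ℝ (LinearMap.range T) = r) :
    ∃ ξ : Fin r → V, LinearIndependent ℝ (fun i ↦ T (ξ i)) := by
  let b := Module.finBasisOfFinrankEq ℝ (LinearMap.range T) hr
  have hb : ∀ i, ∃ ξ, T ξ = b i := fun i ↦ (b i).2
  choose ξ hξ using hb
  refine ⟨ξ, ?_⟩
  simp only [hξ]
  exact b.linearIndependent.map' (LinearMap.range T).subtype (Submodule.ker_subtype _)

variable {E : Type*} [NormedAddCommGroup E] [NormedSpace ℝ E]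
  {P : Type*} [TopologicalSpace P] [ChartedSpace E P] [IsManifold 𝓘(ℝ, E) ∞ P]

/-- The fields `Λ df_i` that form a basis of the range at `x₀` stay independent nearby, and
constancy of the rank makes them span. -/
theorem IsBivectorField.isSmoothConstantRank_range [FiniteDimensional ℝ E] [T2Space P]
    {Λ : SharpField 𝓘(ℝ, E) P}
    (hΛ : IsBivectorField Λ) (hr : HasConstantRank Λ) :
    IsSmoothConstantRank (I := 𝓘(ℝ, E)) fun x : P ↦ LinearMap.range (Λ x).toLinearMap := by
  have : IsManifold 𝓘(ℝ, E) 1 P := IsManifold.of_le (n := ∞) (by simp)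
  obtain ⟨r, hr⟩ := hr
  have hfin : ∀ x : P, FiniteDimensional ℝ (TangentSpace 𝓘(ℝ, E) x) :=
    fun x ↦ inferInstanceAs (FiniteDimensional ℝ E)
  refine ⟨r, fun x₀ ↦ ?_⟩
  obtain ⟨ξ, hξ⟩ := exists_linearIndependent_apply (Λ x₀).toLinearMap (hr x₀)
  choose f hf hfx using fun i ↦ exists_differential_eq x₀ (ξ i)
  let X : Fin r → ∀ x : P, TangentSpace 𝓘(ℝ, E) x := fun i x ↦ Λ x (differential 𝓘(ℝ, E) (f i) x)
  have hX : ∀ i, ContMDiff 𝓘(ℝ, E) 𝓘(ℝ, E).tangent ∞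
      (fun x ↦ (⟨x, X i x⟩ : TangentBundle 𝓘(ℝ, E) P)) :=
    fun i ↦ contMDiff_sharp_differential hΛ (hf i)
  have hlin : LinearIndependent ℝ (fun i ↦ X i x₀) := by
    have h : (fun i ↦ X i x₀) = fun i ↦ (Λ x₀).toLinearMap (ξ i) :=
      funext fun i ↦ congrArg (Λ x₀) (hfx i)
    rw [h]
    exact hξ
  have hlin' : LinearIndependent ℝ (fun i ↦ chartDeriv (E := E) x₀ x₀ (X i x₀)) :=
    hlin.map' (chartDeriv (E := E) x₀ x₀).toLinearMap
      (LinearMap.ker_eq_bot.2 (chartDeriv_bijective (mem_chart_source E x₀)).1)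
  have hcont : ContinuousAt (fun x i ↦ chartDeriv (E := E) x₀ x (X i x)) x₀ :=
    continuousAt_pi.2 fun i ↦ ((contMDiffAt_vectorField_iff (X i) x₀).1 (hX i x₀)).continuousAt
  -- Independence is an open condition on families in one fixed space, hence the passage to `E` by
  -- the chart derivative.
  have hev : ∀ᶠ x in 𝓝 x₀, LinearIndependent ℝ (fun i ↦ chartDeriv (E := E) x₀ x (X i x)) :=
    hcont.eventually hlin'.eventually
  obtain ⟨U, hU, hUo, hxU⟩ := eventually_nhds_iff.1 hev
  refine ⟨U, hUo, hxU, X, fun i ↦ (hX i).contMDiffOn, fun x hx ↦ ?_⟩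
  have hli : LinearIndependent ℝ (fun i ↦ X i x) :=
    LinearIndependent.of_comp (chartDeriv (E := E) x₀ x).toLinearMap (hU x hx)
  refine ⟨hli, Submodule.eq_of_le_of_finrank_eq ?_ ?_⟩
  · rw [Submodule.span_le]
    rintro _ ⟨i, rfl⟩
    exact ⟨_, rfl⟩
  · rw [finrank_span_eq_card hli, Fintype.card_fin, hr]

theorem hasConstantRank_of_isSmoothConstantRank {Λ : SharpField 𝓘(ℝ, E) P}
    (h : IsSmoothConstantRank (I := 𝓘(ℝ, E)) fun x : P ↦ LinearMap.range (Λ x).toLinearMap) :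
    HasConstantRank Λ := by
  obtain ⟨r, hr⟩ := h
  refine ⟨r, fun x ↦ ?_⟩
  obtain ⟨U, -, hx, X, -, hX⟩ := hr x
  obtain ⟨hli, hspan⟩ := hX x hx
  change _ = LinearMap.range (Λ x).toLinearMap at hspan
  rw [← hspan, finrank_span_eq_card hli, Fintype.card_fin]

end Frame

/-! ### Smooth local sections of submersions -/

section Submersion

variable {E₂ : Type*} [NormedAddCommGroup E₂] [NormedSpace ℝ E₂]
  {P₂ : Type*} [TopologicalSpace P₂] [ChartedSpace E₂ P₂] [IsManifold 𝓘(ℝ, E₂) ∞ P₂]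
  {E₃ : Type*} [NormedAddCommGroup E₃] [NormedSpace ℝ E₃] [FiniteDimensional ℝ E₃]
  {P₃ : Type*} [TopologicalSpace P₃] [ChartedSpace E₃ P₃]

/-- On the affine slice `a + T v`, with `T` a right inverse of the derivative, `f` has identity
derivative at `v = 0`; the inverse function theorem applies to this restriction. -/
theorem exists_section_of_contDiffAt {f : E₂ → E₃} {a : E₂} (hf : ContDiffAt ℝ ∞ f a)
    (hs : Surjective (fderiv ℝ f a)) :
    ∃ σ : E₃ → E₂, ContDiffAt ℝ ∞ σ (f a) ∧ σ (f a) = a ∧ ∀ᶠ z in 𝓝 (f a), f (σ z) = z := by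
  have : CompleteSpace E₃ := FiniteDimensional.complete ℝ E₃
  obtain ⟨S, hS⟩ := (fderiv ℝ f a).toLinearMap.exists_rightInverse_of_surjective
    (LinearMap.range_eq_top.2 hs)
  let T : E₃ →L[ℝ] E₂ := LinearMap.toContinuousLinearMap S
  have hT : (fderiv ℝ f a).comp T = ContinuousLinearMap.id ℝ E₃ :=
    ContinuousLinearMap.ext fun v ↦ LinearMap.congr_fun hS v
  let ψ : E₃ → E₂ := fun v ↦ a + T v
  have hψ0 : ψ 0 = a := by simp [ψ]
  have hψ : ContDiff ℝ ∞ ψ := contDiff_const.add T.contDiff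
  have hψ' : HasFDerivAt ψ T 0 := T.hasFDerivAt.const_add a
  have hfa : HasFDerivAt f (fderiv ℝ f a) (ψ 0) := by
    rw [hψ0]
    exact (hf.differentiableAt (by simp)).hasFDerivAt
  have hg : ContDiffAt ℝ ∞ (f ∘ ψ) 0 := by
    refine ContDiffAt.comp _ ?_ hψ.contDiffAt
    rwa [hψ0]
  have hg' : HasFDerivAt (f ∘ ψ) ((ContinuousLinearEquiv.refl ℝ E₃ : E₃ ≃L[ℝ] E₃) : E₃ →L[ℝ] E₃)
      0 := by
    have h := hfa.comp 0 hψ'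
    rw [hT] at h
    exact h
  have hga : (f ∘ ψ) 0 = f a := by rw [comp_apply, hψ0]
  refine ⟨ψ ∘ hg.localInverse hg' (by simp), ?_, ?_, ?_⟩
  · rw [← hga]
    exact hψ.contDiffAt.comp _ (hg.to_localInverse hg' (by simp))
  · rw [← hga, comp_apply, hg.localInverse_apply_image hg' (by simp), hψ0]
  · rw [← hga]
    exact (hg.hasStrictFDerivAt' hg' (by simp)).eventually_right_inverse

/-- Near each point `f` is `f ∘ π` composed with a smooth local section of `π`. -/
theorem contMDiff_of_comp_submersion {π : P₂ → P₃} (hπ : ContMDiff 𝓘(ℝ, E₂) 𝓘(ℝ, E₃) ∞ π)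
    (hsurj : Surjective π) (hsub : ∀ x, Surjective (mfderiv 𝓘(ℝ, E₂) 𝓘(ℝ, E₃) π x)) {f : P₃ → ℝ}
    (hf : ContMDiff 𝓘(ℝ, E₂) 𝓘(ℝ, ℝ) ∞ (f ∘ π)) : ContMDiff 𝓘(ℝ, E₃) 𝓘(ℝ, ℝ) ∞ f := by
  intro q
  obtain ⟨x, rfl⟩ := hsurj q
  let c := extChartAt 𝓘(ℝ, E₂) x
  let d := extChartAt 𝓘(ℝ, E₃) (π x)
  have hw : ContDiffAt ℝ ∞ (d ∘ π ∘ c.symm) (c x) := by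
    have := (contMDiffAt_iff.1 (hπ x)).2
    rwa [modelWithCornersSelf_coe, range_id, contDiffWithinAt_univ] at this
  have hwd : Surjective (fderiv ℝ (d ∘ π ∘ c.symm) (c x)) := by
    have h := ((hπ x).mdifferentiableAt (by simp)).mfderiv
    rw [modelWithCornersSelf_coe, range_id, fderivWithin_univ] at h
    have h' : mfderiv 𝓘(ℝ, E₂) 𝓘(ℝ, E₃) π x = fderiv ℝ (d ∘ π ∘ c.symm) (c x) := h
    rw [← h']
    exact hsub x
  obtain ⟨σ, hσ, hσ0, hσe⟩ := exists_section_of_contDiffAt hw hwd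
  have hx : (d ∘ π ∘ c.symm) (c x) = d (π x) := by
    simp only [comp_apply, c, extChartAt_to_inv]
  rw [hx] at hσ hσ0 hσe
  have hs : ContMDiffAt 𝓘(ℝ, E₃) 𝓘(ℝ, E₂) ∞ (c.symm ∘ σ ∘ d) (π x) := by
    refine ContMDiffAt.comp _ (I' := 𝓘(ℝ, E₂)) ?_
      (hσ.contMDiffAt.comp (I' := 𝓘(ℝ, E₃)) _ contMDiffAt_extChartAt)
    rw [comp_apply, hσ0]
    exact (contMDiffOn_extChartAt_symm x).contMDiffAt (extChartAt_target_mem_nhds x)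
  have hd : Filter.Tendsto d (𝓝 (π x)) (𝓝 (d (π x))) := continuousAt_extChartAt (π x)
  have hσd : Filter.Tendsto (fun q ↦ π (c.symm (σ (d q)))) (𝓝 (π x)) (𝓝 (π x)) := by
    have h := (hπ.continuous.continuousAt (x := (c.symm ∘ σ ∘ d) (π x))).tendsto.comp
      hs.continuousAt.tendsto
    simp only [comp_apply, hσ0, c, extChartAt_to_inv] at h
    exact h
  have heq : ∀ᶠ q in 𝓝 (π x), π (c.symm (σ (d q))) = q := by
    -- The section identity is known only after applying `d`, which is injective just on its source;
    -- so both points must lie there.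
    filter_upwards [hd.eventually hσe, hσd.eventually (extChartAt_source_mem_nhds (I := 𝓘(ℝ, E₃)) (π x)),
      extChartAt_source_mem_nhds (I := 𝓘(ℝ, E₃)) (π x)] with q h1 h2 h3
    exact d.injOn h2 h3 h1
  refine ((hf _).comp (π x) hs).congr_of_eventuallyEq ?_
  filter_upwards [heq] with q hq
  simp only [comp_apply]
  rw [hq]

end Submersion

/-! ### Functions constant on leaves -/

section Leaves

variable {E : Type*} [NormedAddCommGroup E] [NormedSpace ℝ E]
  {P : Type*} [TopologicalSpace P] [ChartedSpace E P]

/-- `f ∘ ι` has zero derivative on the connected open set `U`. -/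
theorem IsIntegralManifold.comp_eq_of_differential_eq_zero {D : Distribution 𝓘(ℝ, E) P} {k : ℕ}
    {U : Set (EuclideanSpace ℝ (Fin k))} {ι : EuclideanSpace ℝ (Fin k) → P}
    (hι : IsIntegralManifold D U ι) {f : P → ℝ} (hf : ContMDiff 𝓘(ℝ, E) 𝓘(ℝ, ℝ) ∞ f)
    (hD : ∀ x, ∀ v ∈ D x, differential 𝓘(ℝ, E) f x v = 0) {x y : P} (hx : x ∈ ι '' U)
    (hy : y ∈ ι '' U) : f x = f y := by
  obtain ⟨u, hu, rfl⟩ := hx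
  obtain ⟨w, hw, rfl⟩ := hy
  have hdiff : ∀ z ∈ U, MDifferentiableAt 𝓘(ℝ, EuclideanSpace ℝ (Fin k)) 𝓘(ℝ, E) ι z :=
    fun z hz ↦ (hι.smooth.contMDiffAt (hι.isOpen.mem_nhds hz)).mdifferentiableAt (by simp)
  have hcomp : ∀ z ∈ U, MDifferentiableAt 𝓘(ℝ, EuclideanSpace ℝ (Fin k)) 𝓘(ℝ, ℝ) (f ∘ ι) z :=
    fun z hz ↦ (hf.mdifferentiable (by simp) _).comp z (hdiff z hz)
  refine hι.isOpen.is_const_of_fderiv_eq_zero (𝕜 := ℝ) (f := f ∘ ι) hι.isConnected.isPreconnected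
    (fun z hz ↦ (hcomp z hz).differentiableAt.differentiableWithinAt) (fun z hz ↦ ?_) hu hw
  refine ContinuousLinearMap.ext fun v ↦ ?_
  have h1 := DFunLike.congr_fun
    (mfderiv_comp z (hf.mdifferentiable (by simp) (ι z)) (hdiff z hz)) v
  rw [mfderiv_eq_fderiv] at h1
  refine h1.trans (hD (ι z) _ ?_)
  rw [← hι.tangent z hz]
  exact ⟨v, rfl⟩

theorem eq_of_leafProj_eq {D : Distribution 𝓘(ℝ, E) P} {f : P → ℝ}
    (hf : ContMDiff 𝓘(ℝ, E) 𝓘(ℝ, ℝ) ∞ f)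
    (hD : ∀ x, ∀ v ∈ D x, differential 𝓘(ℝ, E) f x v = 0) {x y : P}
    (h : leafProj D x = leafProj D y) : f x = f y := by
  have h' : Relation.EqvGen _ x y := Quotient.exact h
  induction h' with
  | rel a b hab =>
    obtain ⟨k, U, ι, hι, ha, hb⟩ := hab
    exact hι.comp_eq_of_differential_eq_zero hf hD ha hb
  | refl a => rfl
  | symm a b _ ih => exact (ih (Quotient.sound (by assumption))).symm
  | trans a b c _ _ ih₁ ih₂ =>
    exact (ih₁ (Quotient.sound (by assumption))).trans (ih₂ (Quotient.sound (by assumption)))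

variable {E₃ : Type*} [NormedAddCommGroup E₃] [NormedSpace ℝ E₃]

/-- Each vector of `D x` is tangent to an integral manifold through `x`; this lies in one leaf,
where the pulled-back function is constant. -/
theorem differential_comp_leafProj_eq_zero {D : Distribution 𝓘(ℝ, E) P} (hD : IsIntegrable D)
    [ChartedSpace E₃ (LeafSpace D)] (hπ : IsQuotientSmoothStructure D 𝓘(ℝ, E₃))
    {f : LeafSpace D → ℝ} (hf : ContMDiff 𝓘(ℝ, E₃) 𝓘(ℝ, ℝ) ∞ f) (x : P) {v : TangentSpace 𝓘(ℝ, E) x}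
    (hv : v ∈ D x) : differential 𝓘(ℝ, E) (f ∘ leafProj D) x v = 0 := by
  obtain ⟨k, U, ι, hι, u, hu, rfl⟩ := hD x
  rw [← hι.tangent u hu] at hv
  obtain ⟨w, rfl⟩ := hv
  have hι' : MDifferentiableAt 𝓘(ℝ, EuclideanSpace ℝ (Fin k)) 𝓘(ℝ, E) ι u :=
    (hι.smooth.contMDiffAt (hι.isOpen.mem_nhds hu)).mdifferentiableAt (by simp)
  have h1 := mfderiv_comp u ((hf.comp hπ.1).mdifferentiable (by simp) (ι u)) hι'
  have h2 : (f ∘ leafProj D) ∘ ι =ᶠ[𝓝 u] fun _ ↦ f (leafProj D (ι u)) := by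
    filter_upwards [hι.isOpen.mem_nhds hu] with z hz
    exact congrArg f (Quotient.sound
      (Relation.EqvGen.rel _ _ ⟨k, U, ι, hι, ⟨z, hz, rfl⟩, ⟨u, hu, rfl⟩⟩))
  rw [h2.mfderiv_eq, mfderiv_const] at h1
  exact (DFunLike.congr_fun h1 w).symm

end Leaves

/-! ### Comparing two Poisson structures -/

section Compatible

variable {E : Type*} [NormedAddCommGroup E] [NormedSpace ℝ E]
  {P : Type*} [TopologicalSpace P] [ChartedSpace E P] [IsManifold 𝓘(ℝ, E) ∞ P]

/-- Skewness gives `η(Δ ξ) = -ξ(Δ η) = 0` for all `η`. -/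
theorem IsBivectorField.apply_eq_zero {Δ : SharpField 𝓘(ℝ, E) P} (hΔ : IsBivectorField Δ) {x : P}
    {ξ : TangentSpace 𝓘(ℝ, E) x →L[ℝ] ℝ} (hξ : ∀ v ∈ LinearMap.range (Δ x).toLinearMap, ξ v = 0) :
    Δ x ξ = 0 := by
  by_contra hne
  obtain ⟨η, hη⟩ : ∃ η : E →L[ℝ] ℝ, η (Δ x ξ) ≠ 0 := SeparatingDual.exists_ne_zero (R := ℝ) hne
  exact hη ((hΔ.skew x ξ η).trans (neg_eq_zero.2 (hξ _ ⟨η, rfl⟩)))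

/-- If the Hamiltonian vector fields of `f` and `g` with respect to two Poisson structures agree,
then the differential of `{f, g}` vanishes on the range of the difference of the bivectors. -/
theorem differential_bracket_sub_eq_zero [FiniteDimensional ℝ E] [T2Space P]
    {Λ Λ' : SharpField 𝓘(ℝ, E) P} (hΛ : IsPoisson Λ)
    (hΛ' : IsPoisson Λ') {f g : P → ℝ} (hf : ContMDiff 𝓘(ℝ, E) 𝓘(ℝ, ℝ) ∞ f)
    (hg : ContMDiff 𝓘(ℝ, E) 𝓘(ℝ, ℝ) ∞ g)
    (hff : ∀ x, Λ x (differential 𝓘(ℝ, E) f x) = Λ' x (differential 𝓘(ℝ, E) f x))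
    (hgg : ∀ x, Λ x (differential 𝓘(ℝ, E) g x) = Λ' x (differential 𝓘(ℝ, E) g x))
    (x : P) {v : TangentSpace 𝓘(ℝ, E) x}
    (hv : v ∈ LinearMap.range ((Λ - Λ') x).toLinearMap) :
    differential 𝓘(ℝ, E) (bracket Λ f g) x v = 0 := by
  have right : ∀ {f : P → ℝ},
      (∀ x, Λ x (differential 𝓘(ℝ, E) f x) = Λ' x (differential 𝓘(ℝ, E) f x)) →
      ∀ h : P → ℝ, bracket Λ h f = bracket Λ' h f :=
    fun hf h ↦ funext fun x ↦ by rw [bracket, bracket, hf]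
  have left : ∀ {f : P → ℝ},
      (∀ x, Λ x (differential 𝓘(ℝ, E) f x) = Λ' x (differential 𝓘(ℝ, E) f x)) →
      ∀ h : P → ℝ, bracket Λ f h = bracket Λ' f h :=
    fun hf h ↦ funext fun x ↦ by
      rw [hΛ.bracket_skew, hΛ'.bracket_skew, right hf]
  obtain ⟨ξ, rfl⟩ := hv
  obtain ⟨h, hh, rfl⟩ := exists_differential_eq x ξ
  have h1 := hΛ.jacobi f g h hf hg hh x
  have h2 := hΛ'.jacobi f g h hf hg hh x
  -- The first two Jacobi terms now agree for both structures, so the third terms `{h, {f, g}}`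
  -- agree too.
  rw [left hff, left hgg, left hgg, right hff] at h1
  rw [← left hff g] at h2
  have h3 := hΛ.bracket_skew (bracket Λ f g) h x
  have h4 := hΛ'.bracket_skew (bracket Λ f g) h x
  have h5 : differential 𝓘(ℝ, E) (bracket Λ f g) x ((Λ - Λ') x (differential 𝓘(ℝ, E) h x)) =
      bracket Λ (bracket Λ f g) h x - bracket Λ' (bracket Λ f g) h x :=
    map_sub (differential 𝓘(ℝ, E) (bracket Λ f g) x) _ _
  refine h5.trans ?_
  linarith

end Compatible

/-! ### Poisson reduction -/

section Quotient

variable {E₂ : Type*} [NormedAddCommGroup E₂] [NormedSpace ℝ E₂]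
  {P₂ : Type*} [TopologicalSpace P₂] [ChartedSpace E₂ P₂]
  {E₃ : Type*} [NormedAddCommGroup E₃] [NormedSpace ℝ E₃] [FiniteDimensional ℝ E₃]
  {P₃ : Type*} [TopologicalSpace P₃] [T2Space P₃] [ChartedSpace E₃ P₃] [IsManifold 𝓘(ℝ, E₃) ∞ P₃]

theorem IsPoissonMap.unique {Λ₂ : SharpField 𝓘(ℝ, E₂) P₂} {Λ₃ Λ₃' : SharpField 𝓘(ℝ, E₃) P₃}
    {π : P₂ → P₃} (hsurj : Surjective π) (h : IsPoissonMap Λ₂ Λ₃ π) (h' : IsPoissonMap Λ₂ Λ₃' π) :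
    Λ₃ = Λ₃' := by
  refine sharpField_ext fun f g hf hg q ↦ ?_
  obtain ⟨x, rfl⟩ := hsurj q
  rw [h.2 f g hf hg, h'.2 f g hf hg]

/-- Poisson reduction: if the brackets of functions pulled back by a surjective submersion are
constant on its fibres, then the Poisson structure descends. -/
theorem IsPoisson.exists_descent [IsManifold 𝓘(ℝ, E₂) ∞ P₂]
    {Λ₂ : SharpField 𝓘(ℝ, E₂) P₂} (hΛ₂ : IsPoisson Λ₂) {π : P₂ → P₃}
    (hπ : ContMDiff 𝓘(ℝ, E₂) 𝓘(ℝ, E₃) ∞ π) (hsurj : Surjective π)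
    (hsub : ∀ x, Surjective (mfderiv 𝓘(ℝ, E₂) 𝓘(ℝ, E₃) π x))
    (hconst : ∀ f g : P₃ → ℝ, ContMDiff 𝓘(ℝ, E₃) 𝓘(ℝ, ℝ) ∞ f → ContMDiff 𝓘(ℝ, E₃) 𝓘(ℝ, ℝ) ∞ g →
      ∀ x y, π x = π y → bracket Λ₂ (f ∘ π) (g ∘ π) x = bracket Λ₂ (f ∘ π) (g ∘ π) y) :
    ∃ Λ₃ : SharpField 𝓘(ℝ, E₃) P₃, IsPoisson Λ₃ ∧ IsPoissonMap Λ₂ Λ₃ π := by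
  choose s hs using hsurj
  -- The choice `s` of a point in each fibre need not be continuous: `hconst` makes the brackets
  -- independent of it, and smoothness is recovered from the submersion.
  let Λ₃ : SharpField 𝓘(ℝ, E₃) P₃ := fun q ↦ pushAt Λ₂ π (s q) q
  have key : ∀ f g : P₃ → ℝ, ContMDiff 𝓘(ℝ, E₃) 𝓘(ℝ, ℝ) ∞ f → ContMDiff 𝓘(ℝ, E₃) 𝓘(ℝ, ℝ) ∞ g →
      bracket Λ₃ f g ∘ π = bracket Λ₂ (f ∘ π) (g ∘ π) := fun f g hf hg ↦ funext fun x ↦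
    (differential_pushAt Λ₂ (hs (π x)) (hπ.mdifferentiable (by simp) _)
      (hf.mdifferentiable (by simp) _) (hg.mdifferentiable (by simp) _)).trans
      (hconst f g hf hg _ _ (hs (π x)))
  have key' : ∀ f g : P₃ → ℝ, ContMDiff 𝓘(ℝ, E₃) 𝓘(ℝ, ℝ) ∞ f →
      ContMDiff 𝓘(ℝ, E₃) 𝓘(ℝ, ℝ) ∞ g → ∀ q,
      bracket Λ₃ f g q = bracket Λ₂ (f ∘ π) (g ∘ π) (s q) := fun f g hf hg q ↦ by
    rw [← key f g hf hg, comp_apply, hs]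
  have hB : IsBivectorField Λ₃ := by
    refine isBivectorField_of_bracket (fun f g hf hg q ↦ ?_) fun f g hf hg ↦ ?_
    · rw [key' f g hf hg, key' g f hg hf, hΛ₂.bracket_skew]
    · refine contMDiff_of_comp_submersion hπ (fun q ↦ ⟨s q, hs q⟩) hsub ?_
      rw [key f g hf hg]
      exact contMDiff_bracket hΛ₂.toIsBivectorField (hf.comp hπ) (hg.comp hπ)
  refine ⟨Λ₃, ⟨hB, fun f g h hf hg hh q ↦ ?_⟩, hπ, fun f g hf hg x ↦ congrFun (key f g hf hg) x⟩
  rw [key' _ _ hf (contMDiff_bracket hB hg hh), key' _ _ hg (contMDiff_bracket hB hh hf),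
    key' _ _ hh (contMDiff_bracket hB hf hg), key g h hg hh, key h f hh hf, key f g hf hg]
  exact hΛ₂.jacobi _ _ _ (hf.comp hπ) (hg.comp hπ) (hh.comp hπ) _

end Quotient

end PoissonGeometry

end

/-! ### The equivalences and the leaf space -/

open PoissonGeometry in
theorem corollaryA5
    {E₁ : Type*} [NormedAddCommGroup E₁] [NormedSpace ℝ E₁] [FiniteDimensional ℝ E₁]
    {P₁ : Type*} [TopologicalSpace P₁] [T2Space P₁] [ChartedSpace E₁ P₁]
    [IsManifold 𝓘(ℝ, E₁) ∞ P₁]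
    {E₂ : Type*} [NormedAddCommGroup E₂] [NormedSpace ℝ E₂] [FiniteDimensional ℝ E₂]
    {P₂ : Type*} [TopologicalSpace P₂] [T2Space P₂] [ChartedSpace E₂ P₂]
    [IsManifold 𝓘(ℝ, E₂) ∞ P₂]
    (Λ₁ : SharpField 𝓘(ℝ, E₁) P₁) (hΛ₁ : IsPoisson Λ₁)
    (Λ₂ : SharpField 𝓘(ℝ, E₂) P₂) (hΛ₂ : IsPoisson Λ₂)
    (φ : P₁ ≃ₘ^∞⟮𝓘(ℝ, E₁), 𝓘(ℝ, E₂)⟯ P₂) :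
    (IsPrePoissonMap Λ₁ Λ₂ φ ↔
      IsBivectorField (Λ₂ - pushforward φ Λ₁) ∧ HasConstantRank (Λ₂ - pushforward φ Λ₁)) ∧
    (IsPrePoissonMap Λ₁ Λ₂ φ ↔ IsSmoothConstantRank (deficit Λ₁ Λ₂ φ)) ∧
    (IsIntegrable (deficit Λ₁ Λ₂ φ) →
      ∀ (E₃ : Type*) [NormedAddCommGroup E₃] [NormedSpace ℝ E₃] [FiniteDimensional ℝ E₃]
        [T2Space (LeafSpace (deficit Λ₁ Λ₂ φ))]
        [ChartedSpace E₃ (LeafSpace (deficit Λ₁ Λ₂ φ))]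
        [IsManifold 𝓘(ℝ, E₃) ∞ (LeafSpace (deficit Λ₁ Λ₂ φ))],
        IsQuotientSmoothStructure (deficit Λ₁ Λ₂ φ) 𝓘(ℝ, E₃) →
        ∃ Λ₃ : SharpField 𝓘(ℝ, E₃) (LeafSpace (deficit Λ₁ Λ₂ φ)),
          (IsPoisson Λ₃ ∧ IsPoissonMap Λ₂ Λ₃ (leafProj (deficit Λ₁ Λ₂ φ))) ∧
          (∀ Λ₃' : SharpField 𝓘(ℝ, E₃) (LeafSpace (deficit Λ₁ Λ₂ φ)),
            IsPoisson Λ₃' → IsPoissonMap Λ₂ Λ₃' (leafProj (deficit Λ₁ Λ₂ φ)) → Λ₃' = Λ₃) ∧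
          IsPoissonMap Λ₁ Λ₃ (leafProj (deficit Λ₁ Λ₂ φ) ∘ φ)) := by 
  have hpush : IsPoisson (pushforward φ Λ₁) := hΛ₁.pushforward φ
  have hΔ : IsBivectorField (Λ₂ - pushforward φ Λ₁) :=
    hΛ₂.toIsBivectorField.sub hpush.toIsBivectorField
  have hrank := isPrePoissonMap_iff_hasConstantRank Λ₁ Λ₂ φ
  refine ⟨hrank.trans ⟨fun h ↦ ⟨hΔ, h⟩, fun h ↦ h.2⟩,
    hrank.trans ⟨hΔ.isSmoothConstantRank_range, hasConstantRank_of_isSmoothConstantRank⟩, ?_⟩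
  intro hD E₃ _ _ _ _ _ _ hπ
  have hsurj : Function.Surjective (leafProj (deficit Λ₁ Λ₂ φ)) := Quotient.mk_surjective
  have hham : ∀ f : LeafSpace (deficit Λ₁ Λ₂ φ) → ℝ, ContMDiff 𝓘(ℝ, E₃) 𝓘(ℝ, ℝ) ∞ f → ∀ y,
      Λ₂ y (differential 𝓘(ℝ, E₂) (f ∘ leafProj (deficit Λ₁ Λ₂ φ)) y) =
        pushforward φ Λ₁ y (differential 𝓘(ℝ, E₂) (f ∘ leafProj (deficit Λ₁ Λ₂ φ)) y) :=
    -- The differential of a pulled-back function annihilates the range of `Δ`, hence is itself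
    -- killed by `Δ`.
    fun f hf y ↦ sub_eq_zero.1
      (hΔ.apply_eq_zero fun v hv ↦ differential_comp_leafProj_eq_zero hD hπ hf y hv)
  obtain ⟨Λ₃, hΛ₃, hmap⟩ := hΛ₂.exists_descent hπ.1 hsurj hπ.2 fun f g hf hg x y hxy ↦
    eq_of_leafProj_eq (contMDiff_bracket hΛ₂.toIsBivectorField (hf.comp hπ.1) (hg.comp hπ.1))
      (fun x v hv ↦ differential_bracket_sub_eq_zero hΛ₂ hpush (hf.comp hπ.1) (hg.comp hπ.1)
        (hham f hf) (hham g hg) x hv) hxy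
  refine ⟨Λ₃, ⟨hΛ₃, hmap⟩, fun Λ₃' _ h ↦ h.unique hsurj hmap, hπ.1.comp φ.contMDiff,
    fun f g hf hg x ↦ ?_⟩
  have h1 := bracket_pushforward Λ₁ φ (hf.comp hπ.1) (hg.comp hπ.1) x
  rw [Function.comp_apply, hmap.2 f g hf hg]
  refine Eq.trans ?_ h1
  -- Equality of the Hamiltonian fields lets `φ_*Λ₁` replace `Λ₂` in the bracket.
  rw [bracket, bracket, hham g hg]
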